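/- Let $G$ be a finite subgroup of $SO(4)$ acting freely on the unit sphere $S^3\subset\mathbb R^4$, let $S=S^3/G$ be the corresponding spherical 3-manifold, and let $cS=D^4/G$ be the cone over $S$, regarded as a $V$-manifold (orbifold) with boundary $S$. A spin structure on $S$ is a twofold covering of the oriented orthonormal frame bundle $\mathrm{Fr}(S)=\mathrm{Fr}(S^3)/G$ which is nontrivial over the frames at each point. A spin structure on $cS$ is a twofold covering of the $V$-frame bundle $\mathrm{Fr}(D^4)/G=(D^4\times SO(4))/G$ whose pullback to the space of oriented orthonormal frames of $D^4$ at $x$ is nontrivial for every $x\in D^4$. Spin structures are considered up to isomorphism of coverings of the frame bundle. A spin structure on $cS$ extends a spin structure $c$ on $S$ if its pullback under the map $\mathrm{Fr}(S)\to \mathrm{Fr}(D^4)/G$ that adds the outward unit normal as first vector is isomorphic to $c$. Then every spin structure on $S$ extends to a spin structure on $cS$, and this extension is unique up to isomorphism. -/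

import Mathlib

/-- Euclidean four-space. -/
abbrev R4 : Type := EuclideanSpace ℝ (Fin 4)

/-- The group `SO(4)` of orientation preserving linear isometries of `ℝ⁴`. -/
noncomputable def SO4 : Subgroup (R4 ≃ₗᵢ[ℝ] R4) where
  carrier := {g | LinearMap.det (g.toLinearEquiv : R4 →ₗ[ℝ] R4) = 1}
  one_mem' := by
    change LinearMap.det (LinearMap.id : R4 →ₗ[ℝ] R4) = 1
    exact LinearMap.det_id
  mul_mem' := by
    intro a b ha hb
    change LinearMap.det ((a.toLinearEquiv : R4 →ₗ[ℝ] R4) * (b.toLinearEquiv : R4 →ₗ[ℝ] R4)) = 1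
    rw [map_mul, ha, hb, one_mul]
  inv_mem' := by
    intro a ha
    have h := LinearEquiv.det_symm_mul_det a.toLinearEquiv
    rw [ha, mul_one] at h
    exact h

/-- Evaluation of a rotation at a vector. -/
noncomputable def rot (g : SO4) (x : R4) : R4 := (g : R4 ≃ₗᵢ[ℝ] R4) x

/-- Positively oriented orthonormal bases of `ℝ⁴`. -/
def IsOrientedFrame (v : Fin 4 → R4) : Prop :=
  Orthonormal ℝ v ∧ 0 < (EuclideanSpace.basisFun (Fin 4) ℝ).toBasis.det v

theorem IsOrientedFrame.rotate (g : SO4) {v : Fin 4 → R4} (hv : IsOrientedFrame v) :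
    IsOrientedFrame (fun i => rot g (v i)) := by
  refine ⟨hv.1.comp_linearIsometryEquiv (g : R4 ≃ₗᵢ[ℝ] R4), ?_⟩
  have h := (EuclideanSpace.basisFun (Fin 4) ℝ).toBasis.det_comp
    ((g : R4 ≃ₗᵢ[ℝ] R4).toLinearEquiv : R4 →ₗ[ℝ] R4) v
  have hg : LinearMap.det ((g : R4 ≃ₗᵢ[ℝ] R4).toLinearEquiv : R4 →ₗ[ℝ] R4) = 1 := g.2
  rw [hg, one_mul] at h
  exact h.symm ▸ hv.2

/-- The oriented orthonormal frame bundle of the closed unit disk `D⁴`: pairs `(x, v)` of a point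
`x` of `D⁴` and a positively oriented orthonormal basis `v` of `T_x D⁴ = ℝ⁴`. -/
def DiskFrame : Type := {p : R4 × (Fin 4 → R4) // ‖p.1‖ ≤ 1 ∧ IsOrientedFrame p.2}

/-- The oriented orthonormal frame bundle of `S³`, oriented as the boundary of `D⁴`: pairs `(x, v)`
of a point `x` of `S³` and a triple `v` of vectors such that `(x, v 0, v 1, v 2)` is a positively
oriented orthonormal basis of `ℝ⁴`, which says that `v` is a positively oriented orthonormal
basis of `T_x S³ = {x}ᗮ` (the outward unit normal `x` comes first). -/
def SphereFrame : Type :=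
  {p : R4 × (Fin 3 → R4) // ‖p.1‖ = 1 ∧ IsOrientedFrame (Fin.cons p.1 p.2)}

instance : TopologicalSpace DiskFrame := instTopologicalSpaceSubtype

instance : TopologicalSpace SphereFrame := instTopologicalSpaceSubtype

/-- The bundle projection of the frame bundle of `D⁴`. -/
def DiskFrame.base (p : DiskFrame) : Metric.closedBall (0 : R4) 1 :=
  ⟨p.1.1, mem_closedBall_zero_iff.2 p.2.1⟩

/-- The bundle projection of the frame bundle of `S³`. -/
def SphereFrame.base (p : SphereFrame) : Metric.sphere (0 : R4) 1 :=
  ⟨p.1.1, mem_sphere_zero_iff_norm.2 p.2.1⟩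

/-- `SO(4)` acts on frames of `D⁴` by differentials: `g (x, v) = (g x, g v)`. -/
noncomputable instance : MulAction SO4 DiskFrame where
  smul g p := ⟨(rot g p.1.1, fun i => rot g (p.1.2 i)),
    ((g : R4 ≃ₗᵢ[ℝ] R4).norm_map p.1.1).le.trans p.2.1, p.2.2.rotate g⟩
  one_smul _ := rfl
  mul_smul _ _ _ := rfl

theorem rot_cons (g : SO4) (x : R4) (v : Fin 3 → R4) :
    (Fin.cons (rot g x) (fun i => rot g (v i)) : Fin 4 → R4) =
      fun i => rot g ((Fin.cons x v : Fin 4 → R4) i) := by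
  funext i
  refine Fin.cases ?_ (fun j => ?_) i <;> simp

/-- `SO(4)` acts on frames of `S³` by differentials: `g (x, v) = (g x, g v)`. -/
noncomputable instance : MulAction SO4 SphereFrame where
  smul g p := ⟨(rot g p.1.1, fun i => rot g (p.1.2 i)),
    ((g : R4 ≃ₗᵢ[ℝ] R4).norm_map p.1.1).trans p.2.1, by
      rw [rot_cons]; exact p.2.2.rotate g⟩
  one_smul _ := rfl
  mul_smul _ _ _ := rfl

/-- A spin structure on the quotient `X / G`, where the group `G` acts on an oriented Riemannian
manifold `X` and, by differentials, on its oriented orthonormal frame bundle `p : F → X`.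
It is a twofold covering of the frame bundle `F / G` of `X / G` which is nontrivial over the
fibres, i.e. which restricts to the nontrivial double covering `Spin(n) → SO(n)` (`n ≥ 3`) over
the oriented orthonormal frames at each point `x` of the uniformizing chart `X`; a double covering
of the (connected) space of frames at `x` is trivial precisely if it has a continuous section.
If `G` acts freely on `X`, then `X / G` is a manifold, the frames at `x` are the fibre of its
frame bundle over the image of `x`, and this is the usual notion. In general it is the notion for
the V-manifold `X / G`, whose V-frame bundle is `F / G`. -/
structure SpinStructure (G : Type) [Group G] {F X : Type} [TopologicalSpace F] [MulAction G F]
    (p : F → X) : Type 1 where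
  /-- The total space of the double covering. -/
  Total : Type
  /-- Its topology. -/
  [top : TopologicalSpace Total]
  /-- The covering projection. -/
  proj : Total → MulAction.orbitRel.Quotient G F
  isCoveringMap : IsCoveringMap proj
  twofold : ∀ b, Nat.card (proj ⁻¹' {b}) = 2
  nontrivial : ∀ x : X, ¬ ∃ s : (p ⁻¹' {x}) → Total, Continuous s ∧
    ∀ f, proj (s f) = (Quotient.mk _ (f : F) : MulAction.orbitRel.Quotient G F)

attribute [instance] SpinStructure.top

/-- Two spaces over `B` are isomorphic if there is a homeomorphism over `B` between them. -/
def IsoOver {B E E' : Type} [TopologicalSpace E] [TopologicalSpace E']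
    (π : E → B) (π' : E' → B) : Prop :=
  ∃ φ : E ≃ₜ E', ∀ e, π' (φ e) = π e

/-- Spin structures on `S = S³ / G`. -/
abbrev SphereSpinStructure (G : Subgroup SO4) : Type 1 := SpinStructure G SphereFrame.base

/-- Spin structures on the V-manifold `cS = D⁴ / G`. -/
abbrev ConeSpinStructure (G : Subgroup SO4) : Type 1 := SpinStructure G DiskFrame.base

/-- A frame of `S³` at `x` gives a frame of `D⁴` at `x` by putting the outward normal first. -/
def SphereFrame.toDisk (p : SphereFrame) : DiskFrame :=
  ⟨(p.1.1, Fin.cons p.1.1 p.1.2), p.2.1.le, p.2.2⟩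

theorem SphereFrame.toDisk_smul (g : SO4) (p : SphereFrame) :
    (g • p).toDisk = g • p.toDisk :=
  Subtype.ext (Prod.ext rfl (rot_cons g p.1.1 p.1.2))

/-- The induced map from the frame bundle of `S` to the frame bundle of `cS`. -/
noncomputable def boundaryFrame (G : Subgroup SO4) :
    MulAction.orbitRel.Quotient G SphereFrame → MulAction.orbitRel.Quotient G DiskFrame :=
  Quotient.map SphereFrame.toDisk (by
    rintro _ b ⟨g, rfl⟩
    exact ⟨g, (SphereFrame.toDisk_smul (g : SO4) b).symm⟩)

/-- The spin structure `d` on `cS` extends the spin structure `c` on `S`: the restriction (pullback)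
of the double covering `d` to the frame bundle of the boundary `S` is isomorphic to `c`. -/
def Extends {G : Subgroup SO4} (d : ConeSpinStructure G) (c : SphereSpinStructure G) : Prop :=
  IsoOver (fun z : (boundaryFrame G).Pullback d.proj => z.fst) c.proj

/-!
The frame bundle of the disk retracts onto that of the sphere. A frame `(x, v)` of `D⁴` determines
the frame `(v 0; v 1, v 2, v 3)` of `S³`, whose base point is the first vector `v 0`. This map
`DiskFrame.toSphere` is left inverse to `SphereFrame.toDisk`, and the other composite sends `(x, v)`
to `(v 0, v)`, so it is homotopic to the identity through `((1 - t) x + t v 0, v)`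
(`DiskFrame.slide`). Everything commutes with `SO(4)`, so for every `G` the map
`Fr(S) → Fr(cS)` has a retraction `sphereRetraction G` which is also a homotopy inverse
(`slideHomotopy`).

The extension of `c` is therefore its pullback along the retraction. It is nontrivial over the
frames at any point `x` of the disk, because the retraction identifies those frames with *all*
frames of `S³`, in particular with a space containing the frames at a point of `S³`. It is unique
because pullbacks of a covering along homotopic maps are isomorphic (`IsoOver.of_homotopy`): if `d'`
restricts to `c`, then `d'` is isomorphic to its pullback along `Fr(cS) → Fr(S) → Fr(cS)`, that is,
to the pullback of `c`.
-/

open Topology unitInterval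

/-! ### Pullbacks of coverings -/

namespace IsoOver

variable {A B C E E' E'' : Type} [TopologicalSpace A] [TopologicalSpace C]
  [TopologicalSpace E] [TopologicalSpace E'] [TopologicalSpace E'']

theorem symm {π : E → B} {π' : E' → B} (h : IsoOver π π') : IsoOver π' π := by
  obtain ⟨φ, hφ⟩ := h
  exact ⟨φ.symm, fun e => by rw [← hφ, φ.apply_symm_apply]⟩

theorem trans {π : E → B} {π' : E' → B} {π'' : E'' → B} (h : IsoOver π π')
    (h' : IsoOver π' π'') : IsoOver π π'' := by
  obtain ⟨φ, hφ⟩ := h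
  obtain ⟨ψ, hψ⟩ := h'
  exact ⟨φ.trans ψ, fun e => (hψ _).trans (hφ e)⟩

theorem pullback {π : E → B} {π' : E' → B} (h : IsoOver π π') (f : A → B) :
    IsoOver (fun z : f.Pullback π => z.fst) (fun z : f.Pullback π' => z.fst) := by
  obtain ⟨φ, hφ⟩ := h
  exact ⟨(Homeomorph.prodCongr (.refl A) φ).subtype fun z => by simp [hφ], fun _ => rfl⟩

theorem pullback_id [TopologicalSpace B] (π : E → B) (hπ : Continuous π) :
    IsoOver (fun z : (id : B → B).Pullback π => z.fst) π :=
  ⟨{ toFun z := z.1.2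
     invFun e := ⟨(π e, e), rfl⟩
     left_inv z := Subtype.ext (Prod.ext z.2.symm rfl)
     right_inv _ := rfl
     continuous_toFun := by fun_prop
     continuous_invFun := by fun_prop }, fun z => z.2.symm⟩

theorem pullback_comp (π : E → B) (f : A → B) {g : C → A}
    (hg : Continuous g) :
    IsoOver (fun z : (f ∘ g).Pullback π => z.fst)
      (fun z : g.Pullback (fun w : f.Pullback π => w.fst) => z.fst) :=
  ⟨{ toFun z := ⟨(z.1.1, ⟨(g z.1.1, z.1.2), z.2⟩), rfl⟩
     invFun z := ⟨(z.1.1, z.1.2.1.2), (congrArg f z.2).trans z.1.2.2⟩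
     left_inv _ := rfl
     right_inv z := Subtype.ext (Prod.ext rfl (Subtype.ext (Prod.ext z.2 rfl)))
     continuous_toFun := by fun_prop
     continuous_invFun := by fun_prop }, fun _ => rfl⟩

end IsoOver

namespace IsCoveringMap

theorem pullback_fst {A B E : Type*} [TopologicalSpace A] [TopologicalSpace B]
    [TopologicalSpace E] {p : E → B} (hp : IsCoveringMap p) {f : A → B} (hf : Continuous f) :
    IsCoveringMap (fun z : f.Pullback p => z.fst) := by
  intro a
  obtain ⟨hI, U, haU, hU, -, H, hH⟩ := hp (f a)
  have hmem (z : f.Pullback p) (hz : z.1.1 ∈ f ⁻¹' U) : z.1.2 ∈ p ⁻¹' U := by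
    rw [Set.mem_preimage, ← z.2]; exact hz
  suffices IsEvenlyCovered (fun z : f.Pullback p => z.fst) a (p ⁻¹' {f a}) from
    this.to_isEvenlyCovered_preimage
  refine
    ⟨hI, f ⁻¹' U, haU, hU.preimage hf,
      (hU.preimage hf).preimage (continuous_fst.comp continuous_subtype_val),
      { toFun z := (⟨z.1.1.1, z.2⟩, (H ⟨z.1.1.2, hmem z.1 z.2⟩).2)
        invFun y := ⟨⟨(y.1.1, H.symm (⟨f y.1.1, y.1.2⟩, y.2)), by simp [← hH]⟩, y.1.2⟩
        left_inv := ?_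
        right_inv y := by simp
        continuous_toFun := ?_
        continuous_invFun := by fun_prop }, fun _ => rfl⟩
  · rintro ⟨⟨⟨x, e⟩, hxe⟩, hx⟩
    have he : e ∈ p ⁻¹' U := hmem ⟨(x, e), hxe⟩ hx
    have : H.symm (⟨f x, hx⟩, (H ⟨e, he⟩).2) = ⟨e, he⟩ :=
      H.symm_apply_eq.2 (Prod.ext (Subtype.ext (hxe.trans (hH ⟨e, he⟩).symm)) rfl)
    simp [this]
  · refine Continuous.prodMk (by fun_prop) (continuous_snd.comp (H.continuous.comp ?_))
    fun_prop

/-- Parallel transport along a homotopy: `(a, e)` with `p e = f₀ a` goes to the end point of the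
lift of the path `F (·, a)` that starts at `e`. -/
noncomputable def transport {A B E : Type*} [TopologicalSpace A] [TopologicalSpace B]
    [TopologicalSpace E] {p : E → B} (hp : IsCoveringMap p) {f₀ f₁ : C(A, B)}
    (F : f₀.Homotopy f₁) (z : (f₀ : A → B).Pullback p) : (f₁ : A → B).Pullback p :=
  ⟨(z.1.1, hp.liftPath (F.evalAt z.1.1).toContinuousMap z.1.2 (by simp [z.2]) 1), by
    have := congrFun (hp.liftPath_lifts (F.evalAt z.1.1).toContinuousMap z.1.2 (by simp [z.2])) 1
    simpa using this.symm⟩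

theorem continuous_transport {A B E : Type*} [TopologicalSpace A] [TopologicalSpace B]
    [TopologicalSpace E] {p : E → B} (hp : IsCoveringMap p) {f₀ f₁ : C(A, B)}
    (F : f₀.Homotopy f₁) : Continuous (hp.transport F) := by
  let H : C(I × (f₀ : A → B).Pullback p, B) := ⟨fun y => F (y.1, y.2.1.1), by fun_prop⟩
  let s : C((f₀ : A → B).Pullback p, E) := ⟨fun z => z.1.2, by fun_prop⟩
  have hs (z) : H (0, z) = p (s z) := by simpa [H, s] using z.2
  refine Continuous.subtype_mk (Continuous.prodMk (by fun_prop) ?_) _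
  exact (hp.liftHomotopy H s hs).continuous.comp (Continuous.prodMk_right 1)

theorem transport_symm_transport {A B E : Type*} [TopologicalSpace A] [TopologicalSpace B]
    [TopologicalSpace E] {p : E → B} (hp : IsCoveringMap p) {f₀ f₁ : C(A, B)}
    (F : f₀.Homotopy f₁) (z : (f₀ : A → B).Pullback p) :
    hp.transport F.symm (hp.transport F z) = z := by
  refine Subtype.ext (Prod.ext rfl ?_)
  have hz : (F.evalAt z.1.1).toContinuousMap 0 = p z.1.2 := by simp [z.2]
  -- The reverse of the lifted path lifts the reversed path, and ends at `z.1.2`.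
  have key := (hp.eq_liftPath_iff' (γ := (F.symm.evalAt z.1.1).toContinuousMap)
    (e := (hp.transport F z).1.2) (by
      rw [← (hp.transport F z).2]; simp [transport])
    (Γ := (hp.liftPath _ _ hz).comp ⟨σ, continuous_symm⟩)).2
    ⟨funext fun t => congrFun (hp.liftPath_lifts _ _ hz) (σ t), by
      simp [transport]⟩
  have := congrArg (fun Γ : C(I, E) => Γ 1) key
  simp only [ContinuousMap.comp_apply, ContinuousMap.coe_mk, symm_one, hp.liftPath_zero] at this
  exact this.symm

end IsCoveringMap

/-- Pullbacks of a covering along homotopic maps are isomorphic: transport along the homotopy has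
transport along the reversed homotopy as its inverse. -/
theorem IsoOver.of_homotopy {A B E : Type} [TopologicalSpace A] [TopologicalSpace B]
    [TopologicalSpace E] {p : E → B} (hp : IsCoveringMap p) {f₀ f₁ : C(A, B)}
    (F : f₀.Homotopy f₁) :
    IsoOver (fun z : (f₀ : A → B).Pullback p => z.fst)
      (fun z : (f₁ : A → B).Pullback p => z.fst) :=
  ⟨{ toFun := hp.transport F
     invFun := hp.transport F.symm
     left_inv := hp.transport_symm_transport F
     right_inv z := by simpa using hp.transport_symm_transport F.symm z
     continuous_toFun := hp.continuous_transport F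
     continuous_invFun := hp.continuous_transport F.symm }, fun _ => rfl⟩

theorem Function.Pullback.card_fst_preimage {A B E : Type*} (f : A → B) (p : E → B) (a : A) :
    Nat.card ((fun z : f.Pullback p => z.fst) ⁻¹' {a}) = Nat.card (p ⁻¹' {f a}) :=
  Nat.card_congr
    { toFun z := ⟨z.1.1.2, z.1.2.symm.trans (congrArg f z.2)⟩
      invFun e := ⟨⟨(a, e.1), e.2.symm⟩, rfl⟩
      left_inv := by rintro ⟨⟨⟨_, e⟩, h⟩, rfl⟩; rfl
      right_inv _ := rfl }

/-! ### The retraction of the frame bundle of the disk -/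

@[fun_prop]
theorem continuous_rot (g : SO4) : Continuous (rot g) :=
  (g : R4 ≃ₗᵢ[ℝ] R4).continuous

instance : ContinuousConstSMul SO4 DiskFrame where
  continuous_const_smul g := by
    refine Continuous.subtype_mk (f := fun p : DiskFrame =>
      ((rot g p.1.1, fun i => rot g (p.1.2 i)) : R4 × (Fin 4 → R4))) ?_ _
    have h : Continuous fun p : DiskFrame => p.1 := continuous_subtype_val
    fun_prop

theorem SphereFrame.continuous_toDisk : Continuous SphereFrame.toDisk := by
  refine Continuous.subtype_mk (f := fun p : SphereFrame =>
    ((p.1.1, Fin.cons p.1.1 p.1.2) : R4 × (Fin 4 → R4))) ?_ _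
  have h : Continuous fun p : SphereFrame => p.1 := continuous_subtype_val
  exact (continuous_fst.comp h).prodMk
    (Continuous.finCons (continuous_fst.comp h) (continuous_snd.comp h))

namespace DiskFrame

/-- The frame of `S³` at the first vector `v 0` of the frame `(x, v)` of `D⁴` that consists of the
remaining vectors of `v`. -/
def toSphere (p : DiskFrame) : SphereFrame :=
  ⟨(p.1.2 0, Fin.tail p.1.2), p.2.2.1.1 0, by rw [Fin.cons_self_tail]; exact p.2.2⟩

theorem continuous_toSphere : Continuous toSphere := by
  refine Continuous.subtype_mk (f := fun p : DiskFrame =>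
    ((p.1.2 0, fun i => p.1.2 i.succ) : R4 × (Fin 3 → R4))) ?_ _
  have h : Continuous fun p : DiskFrame => p.1 := continuous_subtype_val
  fun_prop

/-- The homotopy from the identity to `(x, v) ↦ (v 0, v)` that moves the base point along the
segment from `x` to `v 0` and keeps the frame. -/
noncomputable def slide (t : I) (p : DiskFrame) : DiskFrame :=
  ⟨((1 - t : ℝ) • p.1.1 + (t : ℝ) • p.1.2 0, p.1.2), by
    have h := convex_closedBall (0 : R4) 1 (mem_closedBall_zero_iff.2 p.2.1)
      (mem_closedBall_zero_iff.2 (p.2.2.1.1 0).le) (sub_nonneg.2 t.2.2) t.2.1 (by ring)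
    exact mem_closedBall_zero_iff.1 h, p.2.2⟩

theorem continuous_slide : Continuous fun y : I × DiskFrame => slide y.1 y.2 := by
  refine Continuous.subtype_mk (f := fun y : I × DiskFrame =>
    (((1 - y.1 : ℝ) • y.2.1.1 + (y.1 : ℝ) • y.2.1.2 0, y.2.1.2) : R4 × (Fin 4 → R4))) ?_ _
  have h : Continuous fun y : I × DiskFrame => y.2.1 :=
    continuous_subtype_val.comp continuous_snd
  fun_prop

theorem slide_smul (g : SO4) (t : I) (p : DiskFrame) : slide t (g • p) = g • slide t p := by
  refine Subtype.ext (Prod.ext ?_ rfl)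
  change (1 - t : ℝ) • rot g p.1.1 + (t : ℝ) • rot g (p.1.2 0) =
    rot g ((1 - t : ℝ) • p.1.1 + (t : ℝ) • p.1.2 0)
  simp [rot]

theorem slide_zero (p : DiskFrame) : slide 0 p = p :=
  Subtype.ext (Prod.ext (by simp [slide]) rfl)

theorem slide_one (p : DiskFrame) : slide 1 p = p.toSphere.toDisk :=
  Subtype.ext (Prod.ext (by simp [slide, toSphere, SphereFrame.toDisk])
    (Fin.cons_self_tail p.1.2).symm)

end DiskFrame

/-! ### Passage to the quotient -/

section Quotient

variable (G : Subgroup SO4)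

/-- The retraction of the frame bundle of `cS` onto that of `S` induced by
`DiskFrame.toSphere`. -/
noncomputable def sphereRetraction :
    MulAction.orbitRel.Quotient G DiskFrame → MulAction.orbitRel.Quotient G SphereFrame :=
  Quotient.map DiskFrame.toSphere (by
    rintro _ b ⟨g, rfl⟩
    exact ⟨g, rfl⟩)

theorem continuous_sphereRetraction : Continuous (sphereRetraction G) :=
  DiskFrame.continuous_toSphere.quotient_map' _

theorem continuous_boundaryFrame : Continuous (boundaryFrame G) :=
  SphereFrame.continuous_toDisk.quotient_map' _

theorem sphereRetraction_comp_boundaryFrame : sphereRetraction G ∘ boundaryFrame G = id := by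
  funext q
  induction q using Quotient.inductionOn
  rfl

/-- The homotopy on the frame bundle of `cS` induced by `DiskFrame.slide`. -/
noncomputable def slideHomotopy :
    (ContinuousMap.id (MulAction.orbitRel.Quotient G DiskFrame)).Homotopy
      ⟨boundaryFrame G ∘ sphereRetraction G,
        (continuous_boundaryFrame G).comp (continuous_sphereRetraction G)⟩ where
  toFun y := Quotient.map (DiskFrame.slide y.1) (by
    rintro _ b ⟨g, rfl⟩
    exact ⟨g, (DiskFrame.slide_smul (g : SO4) y.1 b).symm⟩) y.2
  continuous_toFun := by
    have : ContinuousConstSMul G DiskFrame :=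
      ⟨fun g => continuous_const_smul (g : SO4)⟩
    -- The product of the quotient map with `I` is again a quotient map, since both are open.
    have hq : IsOpenQuotientMap (Prod.map id (Quotient.mk _) :
        I × DiskFrame → I × MulAction.orbitRel.Quotient G DiskFrame) :=
      IsOpenQuotientMap.id.prodMap MulAction.isOpenQuotientMap_quotientMk
    rw [hq.isQuotientMap.continuous_iff]
    exact continuous_quot_mk.comp DiskFrame.continuous_slide
  map_zero_left q := by
    induction q using Quotient.inductionOn with
    | h p => exact congrArg (Quotient.mk _) p.slide_zero
  map_one_left q := by
    induction q using Quotient.inductionOn with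
    | h p => exact congrArg (Quotient.mk _) p.slide_one

end Quotient

/-! ### Extension of spin structures -/

/-- The pullback of a spin structure on `S` along the retraction of frame bundles. -/
noncomputable def SphereSpinStructure.toCone {G : Subgroup SO4} (c : SphereSpinStructure G) :
    ConeSpinStructure G where
  Total := (sphereRetraction G).Pullback c.proj
  proj z := z.fst
  isCoveringMap := c.isCoveringMap.pullback_fst (continuous_sphereRetraction G)
  twofold b := (Function.Pullback.card_fst_preimage _ _ b).trans (c.twofold _)
  nontrivial := by
    rintro x ⟨s, hs, hsec⟩
    -- Any point of `S³` will do: its frames embed into the frames at `x` by translation.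
    refine c.nontrivial ⟨EuclideanSpace.single 0 1, by simp⟩ ?_
    let j (f : SphereFrame) : DiskFrame.base ⁻¹' {x} :=
      ⟨⟨(x, f.toDisk.1.2), mem_closedBall_zero_iff.1 x.2, f.toDisk.2.2⟩, rfl⟩
    have hj : Continuous j := by
      refine Continuous.subtype_mk (Continuous.subtype_mk (f := fun f : SphereFrame =>
        ((x, f.toDisk.1.2) : R4 × (Fin 4 → R4))) ?_ _) _
      exact continuous_const.prodMk
        (continuous_snd.comp (continuous_subtype_val.comp SphereFrame.continuous_toDisk))
    refine ⟨fun f => (s (j f)).snd, ?_, fun f => ?_⟩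
    · exact continuous_snd.comp
        (continuous_subtype_val.comp (hs.comp (hj.comp continuous_subtype_val)))
    · exact (s (j f)).2.symm.trans (congrArg (sphereRetraction G) (hsec (j f)))

theorem proposition5 (G : Subgroup SO4) [Finite G]
    (hfree : ∀ g ∈ G, g ≠ 1 → ∀ x : R4, ‖x‖ = 1 → rot g x ≠ x)
    (c : SphereSpinStructure G) :
    ∃ d : ConeSpinStructure G, Extends d c ∧
      ∀ d' : ConeSpinStructure G, Extends d' c → IsoOver d'.proj d.proj := by
  refine ⟨c.toCone, ?_, fun d' hd' => ?_⟩
  · have h := (IsoOver.pullback_comp c.proj (sphereRetraction G) (continuous_boundaryFrame G)).symm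
    rw [sphereRetraction_comp_boundaryFrame] at h
    exact h.trans (.pullback_id _ c.isCoveringMap.continuous)
  · have h₁ := (IsoOver.pullback_id _ d'.isCoveringMap.continuous).symm
    have h₂ := IsoOver.of_homotopy d'.isCoveringMap (slideHomotopy G)
    have h₃ := IsoOver.pullback_comp d'.proj (boundaryFrame G) (continuous_sphereRetraction G)
    exact h₁.trans (h₂.trans (h₃.trans (hd'.pullback (sphereRetraction G))))
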